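/- Let $p_0$ be the unique positive real number with $$\frac{(\sqrt5/6)^{2p_0-1}}{\sqrt{p_0}-\frac{1}{2\sqrt{p_0}}}=\Bigl(1-\sqrt{3/\pi}\Bigr)\pi ,$$ so that $p_0=1.8414$ to four decimal places, and for $p\ge 1$ let $$C(p)=\begin{cases}\sqrt{\pi/3}, & 1\le p\le p_0,\\[4pt] 1+\dfrac{1}{\sqrt{3\pi}}\,\dfrac{(\sqrt5/6)^{2p-1}}{\sqrt p-\frac{1}{2\sqrt p}}, & p>p_0.\end{cases}$$ Then, for every real $p\ge 1$, $$\frac1\pi\int_{-\infty}^{\infty}\left(\frac{\sin^2 t}{t^2}\right)^p dt\;\le\; C(p)\,\frac{\sqrt{3/\pi}}{\sqrt p}\;\le\;\frac{1}{\sqrt p},$$ the integral being finite, and the first two terms are equal if and only if $p=1$. Moreover, as $p\to\infty$ through the reals, $$\lim_{p\to\infty}\;\frac1\pi\int_{-\infty}^{\infty}\left(\frac{\sin^2 t}{t^2}\right)^p dt\Big/\frac{\sqrt{3/\pi}}{\sqrt p}=1 .$$ -/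

import Mathlib

open MeasureTheory Filter Topology

noncomputable section

/-- The integrand `(sin² t / t²)^p`. Its value at the single point `t = 0` is irrelevant
for the integral. -/
def sincPow (p t : ℝ) : ℝ := (Real.sin t ^ 2 / t ^ 2) ^ p

/-- `(√5/6)^(2p-1) / (√p - 1/(2√p))`. -/
def tailTerm (p : ℝ) : ℝ :=
  (Real.sqrt 5 / 6) ^ (2 * p - 1) / (Real.sqrt p - 1 / (2 * Real.sqrt p))

/-- The piecewise factor `C(p)`, for `p ≥ 1`, with threshold `p₀`. -/
def ballConst (p₀ p : ℝ) : ℝ :=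
  if p ≤ p₀ then Real.sqrt (Real.pi / 3)
  else 1 + 1 / Real.sqrt (3 * Real.pi) * tailTerm p

/-- The equation that determines the threshold `p₀`. -/
def ThresholdEq (p₀ : ℝ) : Prop :=
  tailTerm p₀ = (1 - Real.sqrt (3 / Real.pi)) * Real.pi

end

/-!
Write `u = sin² t / t²`, so that `sincPow p t = u ^ p`. Exponents near `1` and
larger exponents need different bounds; the threshold `p₀ ≈ 1.8414` only decides which one is used.

*Exponents in `(1, 2]`.* The integrals of `u`, `u²` and `u³` over the line are `π`, `2π/3` and
`11π/20`: the first by writing `1/t²` as a Laplace transform and applying Tonelli's theorem, the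
other two from the first by integration by parts. So `u dt / π` is a probability measure under which
`u`, a variable with values in `[0, 1]`, has first two moments `2/3` and `11/20`. For `0 < e ≤ 1`
the function `u ↦ u ^ e` is bounded on `[0, 1]` by the quadratic that touches it at `7/20` and meets
it at `1` (`rpow_le_hermite`). The two-point law with masses `20/39` at `7/20` and `19/39` at `1`
has the same two moments, whence `integral_sincPow_one_add_le`:
`1/π ∫ u ^ (1 + e) ≤ 19/39 + (20/39) (7/20) ^ e`. Since `7/20 < exp (-1)` and `20/39 > 1/2`,
this is strictly below `(1 + e) ^ (-1/2)`, also for small `e`. At `p = 1` there is equality.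

*Exponents above `p₀`.* On `|t| ≤ 6/√5` one has `|sin t / t| ≤ exp (-t²/6)`, and beyond that point
`u ≤ 1/t²`. Integrating both bounds gives exactly the asserted constant, with strict inequality
because part of the Gaussian integral is discarded (`integral_sincPow_lt`). As `tailTerm` decreases
strictly on `(1/2, ∞)`, the constant is at most its value at `p₀`, where it equals `√(π/3)`.

*The limit.* The upper bound is the preceding one. For the lower bound,
`u ^ p ≥ exp (-p t²/3) (1 - p t⁴/18)` for `t ≠ 0` once `p ≥ 18` (`exp_mul_le_sincPow`), and the
Gaussian moments turn this into `1 - 3/(8p)` for the ratio.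
-/

/-! ### Moments of `sin² t / t²` -/

/-- Fundamental theorem of calculus on a half-line, in the form needed for Tonelli's theorem. -/
lemma lintegral_Ioi_of_hasDerivAt_of_nonneg {g g' : ℝ → ℝ} {a l : ℝ}
    (hd : ∀ x ∈ Set.Ici a, HasDerivAt g (g' x) x) (h0 : ∀ x ∈ Set.Ioi a, 0 ≤ g' x)
    (hl : Tendsto g atTop (𝓝 l)) :
    ∫⁻ x in Set.Ioi a, ENNReal.ofReal (g' x) = ENNReal.ofReal (l - g a) := by
  rw [← integral_Ioi_of_hasDerivAt_of_nonneg' hd h0 hl]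
  refine (ofReal_integral_eq_lintegral_ofReal (integrableOn_Ioi_deriv_of_nonneg' hd h0 hl) ?_).symm
  filter_upwards [ae_restrict_mem measurableSet_Ioi] with x hx using h0 x hx

lemma tendsto_exp_neg_mul_atTop {s : ℝ} (hs : 0 < s) :
    Tendsto (fun t : ℝ => Real.exp (-(t * s))) atTop (𝓝 0) :=
  Real.tendsto_exp_neg_atTop_nhds_zero.comp (tendsto_id.atTop_mul_const hs)

/-- Laplace transform of `s ↦ s`, scaled by `sin² t`. -/
lemma lintegral_mul_exp_mul_sin_sq {t : ℝ} (ht : 0 < t) :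
    ∫⁻ s in Set.Ioi (0 : ℝ), ENNReal.ofReal (s * Real.exp (-(t * s)) * Real.sin t ^ 2) =
      ENNReal.ofReal (Real.sin t ^ 2 / t ^ 2) := by
  have hd : ∀ s ∈ Set.Ici (0 : ℝ), HasDerivAt
      (fun s : ℝ => -((s / t + 1 / t ^ 2) * Real.exp (-(t * s)) * Real.sin t ^ 2))
      (s * Real.exp (-(t * s)) * Real.sin t ^ 2) s := by
    intro s _
    have h1 : HasDerivAt (fun s : ℝ => Real.exp (-(t * s))) (Real.exp (-(t * s)) * (-(t * 1))) s :=
      ((hasDerivAt_id s).const_mul t).neg.exp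
    have h2 : HasDerivAt (fun s : ℝ => s / t + 1 / t ^ 2) (1 / t) s :=
      ((hasDerivAt_id s).div_const t).add_const _
    refine ((h2.mul h1).mul_const _).neg.congr_deriv ?_
    field_simp
    ring
  rw [lintegral_Ioi_of_hasDerivAt_of_nonneg hd (l := 0)]
  · congr 1
    simp
    ring
  · intro s hs
    have : 0 < s := hs
    positivity
  · have h1 : Tendsto (fun s : ℝ => s * Real.exp (-(t * s))) atTop (𝓝 0) := by
      have := (Real.tendsto_pow_mul_exp_neg_atTop_nhds_zero 1).comp (tendsto_id.const_mul_atTop ht)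
      have := this.const_mul (1 / t)
      simp only [mul_zero] at this
      refine this.congr fun s => ?_
      simp
      field_simp
    have h2 := ((tendsto_exp_neg_mul_atTop ht).const_mul (1 / t ^ 2))
    have h3 := (((h1.const_mul (1 / t)).add h2).mul_const (Real.sin t ^ 2)).neg
    simp only [mul_zero, add_zero, zero_mul, neg_zero] at h3
    refine h3.congr fun s => ?_
    have : Real.exp (-(s * t)) = Real.exp (-(t * s)) := by rw [mul_comm]
    rw [this]
    ring

/-- Laplace transform of `sin²`. -/
lemma lintegral_exp_mul_sin_sq {s : ℝ} (hs : 0 < s) :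
    ∫⁻ t in Set.Ioi (0 : ℝ), ENNReal.ofReal (s * Real.exp (-(t * s)) * Real.sin t ^ 2) =
      ENNReal.ofReal (2 / (s ^ 2 + 4)) := by
  have hs4 : s ^ 2 + 4 ≠ 0 := by positivity
  have hd : ∀ t ∈ Set.Ici (0 : ℝ), HasDerivAt
      (fun t : ℝ => Real.exp (-(t * s)) *
        (-(1 / 2) - s / 2 * (2 * Real.sin (2 * t) - s * Real.cos (2 * t)) / (s ^ 2 + 4)))
      (s * Real.exp (-(t * s)) * Real.sin t ^ 2) t := by
    intro t _
    have h1 : HasDerivAt (fun t : ℝ => Real.exp (-(t * s))) (Real.exp (-(t * s)) * (-(1 * s))) t :=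
      ((hasDerivAt_id t).mul_const s).neg.exp
    have h0 : HasDerivAt (fun t : ℝ => 2 * t) (2 * 1) t := (hasDerivAt_id t).const_mul 2
    have h2 := (((((h0.sin.const_mul 2).sub (h0.cos.const_mul s)).const_mul (s / 2)).div_const
      (s ^ 2 + 4)).const_sub (-(1 / 2)))
    refine (h1.mul h2).congr_deriv ?_
    have hc : Real.sin t ^ 2 = (1 - Real.cos (2 * t)) / 2 := by
      rw [Real.sin_sq_eq_half_sub]; ring
    rw [hc]
    simp only [Pi.sub_apply]
    field_simp
    ring
  rw [lintegral_Ioi_of_hasDerivAt_of_nonneg hd (l := 0)]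
  · congr 1
    simp
    field_simp
    ring
  · intro t _
    positivity
  · refine (tendsto_exp_neg_mul_atTop hs).zero_mul_isBoundedUnder_le ?_
    refine isBoundedUnder_of ⟨1 / 2 + |s / 2| * (2 + |s|) / (s ^ 2 + 4), fun t => ?_⟩
    simp only [Function.comp_apply, Real.norm_eq_abs]
    have h3 : |2 * Real.sin (2 * t) - s * Real.cos (2 * t)| ≤ 2 + |s| := by
      refine (abs_sub _ _).trans ?_
      rw [abs_mul, abs_mul, abs_two]
      gcongr
      · linarith [Real.abs_sin_le_one (2 * t)]
      · nlinarith [Real.abs_cos_le_one (2 * t), abs_nonneg s]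
    refine (abs_sub _ _).trans ?_
    rw [abs_div, abs_mul, abs_neg, abs_of_pos (show (0 : ℝ) < s ^ 2 + 4 by positivity),
      abs_of_pos (show (0 : ℝ) < 1 / 2 by norm_num)]
    gcongr

lemma lintegral_two_div_sq_add_four :
    ∫⁻ s in Set.Ioi (0 : ℝ), ENNReal.ofReal (2 / (s ^ 2 + 4)) = ENNReal.ofReal (Real.pi / 2) := by
  have hd : ∀ s ∈ Set.Ici (0 : ℝ), HasDerivAt (fun s : ℝ => Real.arctan (s / 2))
      (2 / (s ^ 2 + 4)) s := by
    intro s _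
    refine (((hasDerivAt_id s).div_const 2).arctan).congr_deriv ?_
    simp
    field_simp
    ring
  rw [lintegral_Ioi_of_hasDerivAt_of_nonneg hd (l := Real.pi / 2)]
  · simp
  · intro s _
    positivity
  · exact (tendsto_nhds_of_tendsto_nhdsWithin Real.tendsto_arctan_atTop).comp
      (tendsto_id.atTop_div_const two_pos)

lemma lintegral_sin_sq_div_sq :
    ∫⁻ t in Set.Ioi (0 : ℝ), ENNReal.ofReal (Real.sin t ^ 2 / t ^ 2) =
      ENNReal.ofReal (Real.pi / 2) := by
  rw [← lintegral_two_div_sq_add_four,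
    ← setLIntegral_congr_fun measurableSet_Ioi fun t ht => lintegral_mul_exp_mul_sin_sq ht,
    ← setLIntegral_congr_fun measurableSet_Ioi fun s hs => lintegral_exp_mul_sin_sq hs]
  exact lintegral_lintegral_swap (by fun_prop)

lemma integrableOn_sin_sq_div_sq :
    IntegrableOn (fun t : ℝ => Real.sin t ^ 2 / t ^ 2) (Set.Ioi 0) := by
  refine ⟨(by fun_prop : Measurable _).aestronglyMeasurable, ?_⟩
  rw [hasFiniteIntegral_iff_ofReal (ae_of_all _ fun t => by positivity), lintegral_sin_sq_div_sq]
  exact ENNReal.ofReal_lt_top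

lemma integral_sin_sq_div_sq :
    ∫ t in Set.Ioi (0 : ℝ), Real.sin t ^ 2 / t ^ 2 = Real.pi / 2 := by
  rw [integral_eq_lintegral_of_nonneg_ae (ae_of_all _ fun t => by positivity)
    (by fun_prop : Measurable _).aestronglyMeasurable,
    lintegral_sin_sq_div_sq, ENNReal.toReal_ofReal (by positivity)]

lemma integrableOn_sin_mul_sq_div_sq {k : ℝ} (hk : 0 < k) :
    IntegrableOn (fun t : ℝ => Real.sin (k * t) ^ 2 / t ^ 2) (Set.Ioi 0) := by
  have h := (integrableOn_Ioi_comp_mul_left_iff (fun t : ℝ => Real.sin t ^ 2 / t ^ 2) 0 hk).2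
    (by simpa using integrableOn_sin_sq_div_sq)
  refine (h.const_mul (k ^ 2)).congr (ae_of_all _ fun t => ?_)
  simp only [mul_pow]
  field_simp

lemma integral_sin_mul_sq_div_sq {k : ℝ} (hk : 0 < k) :
    ∫ t in Set.Ioi (0 : ℝ), Real.sin (k * t) ^ 2 / t ^ 2 = k * (Real.pi / 2) := by
  have h := integral_comp_mul_left_Ioi (fun t : ℝ => Real.sin t ^ 2 / t ^ 2) 0 hk
  rw [mul_zero, integral_sin_sq_div_sq, smul_eq_mul] at h
  have h2 : (fun t : ℝ => Real.sin (k * t) ^ 2 / t ^ 2) =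
      fun t => k ^ 2 * (Real.sin (k * t) ^ 2 / (k * t) ^ 2) := by
    funext t
    simp only [mul_pow]
    field_simp
  rw [h2, integral_const_mul, h]
  field_simp

/-- `sin⁴ t / t⁴` is dominated by `sin² t / t²`, and likewise for higher powers. -/
lemma integrableOn_sin_pow_div_pow {n : ℕ} (hn : 2 ≤ n) :
    IntegrableOn (fun t : ℝ => Real.sin t ^ n / t ^ n) (Set.Ioi 0) := by
  refine integrableOn_sin_sq_div_sq.mono' (by fun_prop : Measurable _).aestronglyMeasurable
    (ae_of_all _ fun t => ?_)
  have h1 : |Real.sin t / t| ≤ 1 := by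
    rw [abs_div]
    exact div_le_one_of_le₀ Real.abs_sin_le_abs (abs_nonneg t)
  rw [← div_pow, ← div_pow, norm_pow, Real.norm_eq_abs, ← sq_abs (Real.sin t / t)]
  exact pow_le_pow_of_le_one (abs_nonneg _) h1 hn

/-- A function `t ↦ G t` bounded by `C |t|` and by `C / t` has limit `0` at both ends of
`(0, ∞)`, so its derivative has integral `0` there. -/
lemma integral_Ioi_deriv_eq_zero {G G' : ℝ → ℝ} {C : ℝ}
    (hd : ∀ t ∈ Set.Ioi (0 : ℝ), HasDerivAt G (G' t) t) (hi : IntegrableOn G' (Set.Ioi 0))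
    (h0 : G 0 = 0) (hsmall : ∀ t, 0 < t → |G t| ≤ C * t) (hlarge : ∀ t, 1 ≤ t → |G t| ≤ C / t) :
    ∫ t in Set.Ioi (0 : ℝ), G' t = 0 := by
  have hc : ContinuousWithinAt G (Set.Ici 0) 0 := by
    rw [ContinuousWithinAt, h0]
    refine squeeze_zero_norm' (a := fun t => C * t) ?_ ?_
    · filter_upwards [self_mem_nhdsWithin] with t ht
      rcases eq_or_lt_of_le (show (0 : ℝ) ≤ t from ht) with h | h
      · simp [← h, h0]
      · exact hsmall t h
    · have : Tendsto (fun t : ℝ => C * t) (𝓝 0) (𝓝 (C * 0)) := tendsto_id.const_mul C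
      rw [mul_zero] at this
      exact this.mono_left nhdsWithin_le_nhds
  have ht : Tendsto G atTop (𝓝 0) := by
    refine squeeze_zero_norm' (a := fun t => C / t) ?_ (tendsto_const_nhds.div_atTop tendsto_id)
    filter_upwards [eventually_ge_atTop 1] with t ht using hlarge t ht
  rw [integral_Ioi_of_hasDerivAt_of_tendsto hc hd hi ht, h0, sub_zero]

lemma abs_sin_pow_mul_div_pow_le {t e : ℝ} {a m : ℕ} (ht : 0 < t) (ham : m + 1 ≤ a)
    (he : |e| ≤ 1) : |Real.sin t ^ a * e / t ^ m| ≤ t := by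
  rw [abs_div, abs_mul, abs_pow, abs_pow, abs_of_pos ht, div_le_iff₀ (by positivity), ← pow_succ']
  calc |Real.sin t| ^ a * |e| ≤ |Real.sin t| ^ a * 1 := by gcongr
    _ ≤ |Real.sin t| ^ (m + 1) := by
      rw [mul_one]
      exact pow_le_pow_of_le_one (abs_nonneg _) (Real.abs_sin_le_one t) ham
    _ ≤ t ^ (m + 1) := by
      gcongr
      simpa [abs_of_pos ht] using (Real.abs_sin_le_abs (x := t))

lemma abs_sin_pow_mul_div_pow_le_inv {t e : ℝ} {a m : ℕ} (ht : 1 ≤ t) (hm : m ≠ 0)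
    (he : |e| ≤ 1) : |Real.sin t ^ a * e / t ^ m| ≤ 1 / t := by
  have h0 : 0 < t := by linarith
  rw [abs_div, abs_mul, abs_pow, abs_pow, abs_of_pos h0]
  have h1 : |Real.sin t| ^ a ≤ 1 := pow_le_one₀ (abs_nonneg _) (Real.abs_sin_le_one t)
  have h2 : t ≤ t ^ m := le_self_pow₀ ht hm
  gcongr
  exact mul_le_one₀ h1 (abs_nonneg _) he

lemma integral_sin_pow_four_div :
    ∫ t in Set.Ioi (0 : ℝ), Real.sin t ^ 4 / t ^ 4 = Real.pi / 3 := by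
  -- Two integrations by parts; `(sin⁴)'' = 4 sin² 2t - 4 sin² t`.
  have key := integral_Ioi_deriv_eq_zero (C := 1)
    (G := fun t => -(1 / 3) * (Real.sin t ^ 4 * 1 / t ^ 3)
      - 2 / 3 * (Real.sin t ^ 3 * Real.cos t / t ^ 2))
    (G' := fun t => Real.sin t ^ 4 / t ^ 4 - 2 / 3 * (Real.sin (2 * t) ^ 2 / t ^ 2)
      + 2 / 3 * (Real.sin t ^ 2 / t ^ 2)) ?_ ?_ ?_ ?_ ?_
  · rw [integral_add, integral_sub, integral_const_mul, integral_const_mul, integral_sin_sq_div_sq,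
      integral_sin_mul_sq_div_sq two_pos] at key
    · linarith
    · exact integrableOn_sin_pow_div_pow (by norm_num)
    · exact (integrableOn_sin_mul_sq_div_sq two_pos).const_mul _
    · exact (integrableOn_sin_pow_div_pow (by norm_num)).sub
        ((integrableOn_sin_mul_sq_div_sq two_pos).const_mul _)
    · exact integrableOn_sin_sq_div_sq.const_mul _
  · intro t ht
    have ht0 : t ≠ 0 := ne_of_gt ht
    have hs := Real.hasDerivAt_sin t
    have hc := Real.hasDerivAt_cos t
    have h1 := (((hs.fun_pow 4).mul_const 1).fun_div (hasDerivAt_pow 3 t)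
      (pow_ne_zero 3 ht0)).const_mul (-(1 / 3))
    have h2 := (((hs.fun_pow 3).fun_mul hc).fun_div (hasDerivAt_pow 2 t)
      (pow_ne_zero 2 ht0)).const_mul (2 / 3)
    refine (h1.fun_sub h2).congr_deriv ?_
    rw [Real.sin_two_mul]
    field_simp
    have hcc : Real.cos t ^ 2 = 1 - Real.sin t ^ 2 := Real.cos_sq' t
    simp only [hcc]
    ring_nf
  · exact ((integrableOn_sin_pow_div_pow (by norm_num)).sub
      ((integrableOn_sin_mul_sq_div_sq two_pos).const_mul _)).add
      (integrableOn_sin_sq_div_sq.const_mul _)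
  · simp
  · intro t ht
    have h1 := abs_le.1 (abs_sin_pow_mul_div_pow_le (a := 4) (m := 3) ht le_rfl abs_one.le)
    have h2 := abs_le.1 (abs_sin_pow_mul_div_pow_le (a := 3) (m := 2) ht le_rfl
      (Real.abs_cos_le_one t))
    exact abs_le.2 ⟨by linarith, by linarith⟩
  · intro t ht
    have h1 := abs_le.1 (abs_sin_pow_mul_div_pow_le_inv (a := 4) (m := 3) ht (by norm_num)
      abs_one.le)
    have h2 := abs_le.1 (abs_sin_pow_mul_div_pow_le_inv (a := 3) (m := 2) ht (by norm_num)
      (Real.abs_cos_le_one t))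
    exact abs_le.2 ⟨by linarith, by linarith⟩

lemma integral_sin_pow_six_div :
    ∫ t in Set.Ioi (0 : ℝ), Real.sin t ^ 6 / t ^ 6 = 11 * Real.pi / 40 := by
  -- Four integrations by parts; `(sin⁶)'''' = 15 sin² t - 96 sin² 2t + 81 sin² 3t`.
  have i2 := (integrableOn_sin_mul_sq_div_sq two_pos).const_mul (4 / 5)
  have i3 := (integrableOn_sin_mul_sq_div_sq three_pos).const_mul (27 / 40)
  have i1 := integrableOn_sin_sq_div_sq.const_mul (1 / 8)
  have i6 := integrableOn_sin_pow_div_pow (n := 6) (by norm_num)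
  have key := integral_Ioi_deriv_eq_zero (C := 22 / 5)
    (G := fun t => -(1 / 5) * (Real.sin t ^ 6 * 1 / t ^ 5)
      - 3 / 10 * (Real.sin t ^ 5 * Real.cos t / t ^ 4) - 1 / 2 * (Real.sin t ^ 4 * 1 / t ^ 3)
      + 3 / 5 * (Real.sin t ^ 6 * 1 / t ^ 3) - 1 * (Real.sin t ^ 3 * Real.cos t / t ^ 2)
      + 9 / 5 * (Real.sin t ^ 5 * Real.cos t / t ^ 2))
    (G' := fun t => Real.sin t ^ 6 / t ^ 6 + 4 / 5 * (Real.sin (2 * t) ^ 2 / t ^ 2)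
      - 1 / 8 * (Real.sin t ^ 2 / t ^ 2) - 27 / 40 * (Real.sin (3 * t) ^ 2 / t ^ 2))
    ?_ ?_ ?_ ?_ ?_
  · rw [integral_sub, integral_sub, integral_add, integral_const_mul, integral_const_mul,
      integral_const_mul, integral_sin_sq_div_sq, integral_sin_mul_sq_div_sq two_pos,
      integral_sin_mul_sq_div_sq three_pos] at key
    · linarith
    · exact i6
    · exact i2
    · exact i6.add i2
    · exact i1
    · exact (i6.add i2).sub i1
    · exact i3
  · intro t ht
    have ht0 : t ≠ 0 := ne_of_gt ht
    have hs := Real.hasDerivAt_sin t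
    have hc := Real.hasDerivAt_cos t
    have h1 := (((hs.fun_pow 6).mul_const 1).fun_div (hasDerivAt_pow 5 t)
      (pow_ne_zero 5 ht0)).const_mul (-(1 / 5))
    have h2 := (((hs.fun_pow 5).fun_mul hc).fun_div (hasDerivAt_pow 4 t)
      (pow_ne_zero 4 ht0)).const_mul (3 / 10)
    have h3 := (((hs.fun_pow 4).mul_const 1).fun_div (hasDerivAt_pow 3 t)
      (pow_ne_zero 3 ht0)).const_mul (1 / 2)
    have h4 := (((hs.fun_pow 6).mul_const 1).fun_div (hasDerivAt_pow 3 t)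
      (pow_ne_zero 3 ht0)).const_mul (3 / 5)
    have h5 := (((hs.fun_pow 3).fun_mul hc).fun_div (hasDerivAt_pow 2 t)
      (pow_ne_zero 2 ht0)).const_mul 1
    have h6 := (((hs.fun_pow 5).fun_mul hc).fun_div (hasDerivAt_pow 2 t)
      (pow_ne_zero 2 ht0)).const_mul (9 / 5)
    refine (((((h1.fun_sub h2).fun_sub h3).fun_add h4).fun_sub h5).fun_add h6).congr_deriv ?_
    rw [Real.sin_two_mul, Real.sin_three_mul]
    have hcc : Real.cos t ^ 2 = 1 - Real.sin t ^ 2 := Real.cos_sq' t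
    field_simp
    ring_nf
    simp only [hcc]
    ring
  · exact ((i6.add i2).sub i1).sub i3
  · simp
  · intro t ht
    have hc := Real.abs_cos_le_one t
    have h1 := abs_le.1 (abs_sin_pow_mul_div_pow_le (a := 6) (m := 5) ht le_rfl abs_one.le)
    have h2 := abs_le.1 (abs_sin_pow_mul_div_pow_le (a := 5) (m := 4) ht le_rfl hc)
    have h3 := abs_le.1 (abs_sin_pow_mul_div_pow_le (a := 4) (m := 3) ht le_rfl abs_one.le)
    have h4 := abs_le.1 (abs_sin_pow_mul_div_pow_le (a := 6) (m := 3) ht (by norm_num) abs_one.le)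
    have h5 := abs_le.1 (abs_sin_pow_mul_div_pow_le (a := 3) (m := 2) ht le_rfl hc)
    have h6 := abs_le.1 (abs_sin_pow_mul_div_pow_le (a := 5) (m := 2) ht (by norm_num) hc)
    exact abs_le.2 ⟨by linarith, by linarith⟩
  · intro t ht
    have hc := Real.abs_cos_le_one t
    have h (a m : ℕ) (e : ℝ) (hm : m ≠ 0) (he : |e| ≤ 1) :=
      abs_le.1 (abs_sin_pow_mul_div_pow_le_inv (a := a) ht hm he)
    have h1 := h 6 5 1 (by norm_num) abs_one.le
    have h2 := h 5 4 _ (by norm_num) hc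
    have h3 := h 4 3 1 (by norm_num) abs_one.le
    have h4 := h 6 3 1 (by norm_num) abs_one.le
    have h5 := h 3 2 _ (by norm_num) hc
    have h6 := h 5 2 _ (by norm_num) hc
    rw [div_eq_mul_one_div (22 / 5 : ℝ) t]
    exact abs_le.2 ⟨by linarith, by linarith⟩

/-! ### The inequality for exponents close to `1` -/

lemma concaveOn_affine_sub_rpow {e : ℝ} (he0 : 0 ≤ e) (he1 : e ≤ 1) (a b : ℝ) :
    ConcaveOn ℝ (Set.Ioi 0) (fun x : ℝ => a + b * x - e * x ^ (e - 1)) := by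
  have hd : ∀ x ∈ Set.Ioi (0 : ℝ), HasDerivAt (fun x : ℝ => a + b * x - e * x ^ (e - 1))
      (b - e * ((e - 1) * x ^ (e - 1 - 1))) x := fun x hx =>
    ((((hasDerivAt_id x).const_mul b).const_add a).sub
      ((Real.hasDerivAt_rpow_const (Or.inl (ne_of_gt hx))).const_mul e)).congr_deriv (by simp)
  refine AntitoneOn.concaveOn_of_deriv (convex_Ioi 0)
    (fun x hx => (hd x hx).continuousAt.continuousWithinAt) ?_ ?_
  · rw [interior_Ioi]
    exact fun x hx => (hd x hx).differentiableAt.differentiableWithinAt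
  · rw [interior_Ioi]
    intro x hx y hy hxy
    rw [(hd x hx).deriv, (hd y hy).deriv]
    have h1 : y ^ (e - 1 - 1) ≤ x ^ (e - 1 - 1) :=
      Real.rpow_le_rpow_of_nonpos hx hxy (by linarith)
    have h2 : 0 ≤ e * (1 - e) := mul_nonneg he0 (by linarith)
    nlinarith

/-- The quadratic that agrees with `u ↦ u ^ e` to second order at `l` and agrees with it at `1`
lies above it on `[0, 1]`. The difference vanishes at `l` and `1`, and its derivative is concave
with zeros at `l` and at some point of `(l, 1)`, which fixes where the difference increases. -/
lemma rpow_le_hermite {l e u c : ℝ} (hl : 0 < l) (hl1 : l < 1) (he0 : 0 < e) (he1 : e ≤ 1)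
    (hu : 0 ≤ u) (hu1 : u ≤ 1) (hc : c * (1 - l) ^ 2 = 1 - l ^ e - e * l ^ (e - 1) * (1 - l)) :
    u ^ e ≤ l ^ e + e * l ^ (e - 1) * (u - l) + c * (u - l) ^ 2 := by
  set F : ℝ → ℝ := fun x => l ^ e + e * l ^ (e - 1) * (x - l) + c * (x - l) ^ 2 - x ^ e with hF
  set F' : ℝ → ℝ := fun x => (e * l ^ (e - 1) - 2 * c * l) + 2 * c * x - e * x ^ (e - 1) with hF'
  have hd : ∀ x : ℝ, 0 < x → HasDerivAt F (F' x) x := by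
    intro x hx
    have h1 := (((hasDerivAt_id x).sub_const l).const_mul (e * l ^ (e - 1))).const_add (l ^ e)
    have h2 := (((hasDerivAt_id x).sub_const l).fun_pow 2).const_mul c
    refine ((h1.fun_add h2).fun_sub
      (Real.hasDerivAt_rpow_const (p := e) (Or.inl hx.ne'))).congr_deriv ?_
    simp [hF']
    ring
  have hcont : Continuous F := by
    have := Real.continuous_rpow_const he0.le
    fun_prop
  have hconc : ConcaveOn ℝ (Set.Ioi 0) F' := concaveOn_affine_sub_rpow he0.le he1 _ _
  have hFl : F l = 0 := by simp [hF]
  have hF1 : F 1 = 0 := by simp [hF]; linarith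
  have hF'l : F' l = 0 := by simp [hF']
  obtain ⟨m, hm, hF'm⟩ := exists_hasDerivAt_eq_zero hl1 hcont.continuousOn (hFl.trans hF1.symm)
    fun x hx => hd x (hl.trans hx.1)
  have hm0 : 0 < m := hl.trans hm.1
  have hderiv : ∀ x : ℝ, 0 < x → deriv F x = F' x := fun x hx => (hd x hx).deriv
  suffices 0 ≤ F u by simp only [hF] at this; linarith
  rcases le_total u l with hul | hlu
  · have hanti : AntitoneOn F (Set.Icc 0 l) := by
      refine antitoneOn_of_deriv_nonpos (convex_Icc 0 l) hcont.continuousOn ?_ ?_ <;>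
        rw [interior_Icc]
      · exact fun x hx => (hd x hx.1).differentiableAt.differentiableWithinAt
      · intro x hx
        rw [hderiv x hx.1]
        have := hconc.slope_anti_adjacent (Set.mem_Ioi.2 hx.1) (Set.mem_Ioi.2 hm0) hx.2 hm.1
        rw [hF'l, hF'm, sub_zero, zero_div, zero_sub, le_div_iff₀ (by linarith [hx.2])] at this
        linarith
    rw [← hFl]
    exact hanti ⟨hu, hul⟩ ⟨hl.le, le_rfl⟩ hul
  rcases le_total u m with hum | hmu
  · have hmono : MonotoneOn F (Set.Icc l m) := by
      refine monotoneOn_of_deriv_nonneg (convex_Icc l m) hcont.continuousOn ?_ ?_ <;>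
        rw [interior_Icc]
      · exact fun x hx => (hd x (hl.trans hx.1)).differentiableAt.differentiableWithinAt
      · intro x hx
        rw [hderiv x (hl.trans hx.1)]
        have := hconc.min_le_of_mem_Icc (Set.mem_Ioi.2 hl) (Set.mem_Ioi.2 hm0)
          ⟨hx.1.le, hx.2.le⟩
        rwa [hF'l, hF'm, min_self] at this
    rw [← hFl]
    exact hmono ⟨le_rfl, hm.1.le⟩ ⟨hlu, hum⟩ hlu
  · have hanti : AntitoneOn F (Set.Icc m 1) := by
      refine antitoneOn_of_deriv_nonpos (convex_Icc m 1) hcont.continuousOn ?_ ?_ <;>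
        rw [interior_Icc]
      · exact fun x hx => (hd x (hm0.trans hx.1)).differentiableAt.differentiableWithinAt
      · intro x hx
        rw [hderiv x (hm0.trans hx.1)]
        have := hconc.slope_anti_adjacent (Set.mem_Ioi.2 hl) (Set.mem_Ioi.2 (hm0.trans hx.1))
          hm.1 hx.1
        rw [hF'l, hF'm, sub_zero, sub_zero, zero_div, div_le_iff₀ (by linarith [hx.1])] at this
        linarith
    rw [← hF1]
    exact hanti ⟨hmu, hu1⟩ ⟨hm.2.le, le_rfl⟩ hu1

lemma sin_sq_div_sq_le_one (t : ℝ) : Real.sin t ^ 2 / t ^ 2 ≤ 1 :=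
  div_le_one_of_le₀ (sq_le_sq.2 Real.abs_sin_le_abs) (sq_nonneg t)

lemma sincPow_nonneg (p t : ℝ) : 0 ≤ sincPow p t := by
  unfold sincPow
  positivity

lemma measurable_sincPow (p : ℝ) : Measurable (sincPow p) := by
  unfold sincPow
  fun_prop

lemma integrable_sincPow {p : ℝ} (hp : 1 ≤ p) : Integrable (sincPow p) := by
  refine (integrable_inv_one_add_sq.const_mul 2).mono'
    (measurable_sincPow p).aestronglyMeasurable (ae_of_all _ fun t => ?_)
  have h0 : 0 ≤ Real.sin t ^ 2 / t ^ 2 := by positivity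
  rw [Real.norm_of_nonneg (sincPow_nonneg p t)]
  calc sincPow p t ≤ (Real.sin t ^ 2 / t ^ 2) ^ (1 : ℝ) :=
        Real.rpow_le_rpow_of_exponent_ge_of_imp h0 (sin_sq_div_sq_le_one t) hp (by grind)
    _ = Real.sin t ^ 2 / t ^ 2 := Real.rpow_one _
    _ ≤ 2 * (1 + t ^ 2)⁻¹ := by
      rw [← div_eq_mul_inv, le_div_iff₀ (by positivity), mul_add, mul_one]
      have h1 := sin_sq_div_sq_le_one t
      have h2 : Real.sin t ^ 2 / t ^ 2 * t ^ 2 ≤ 1 := by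
        rcases eq_or_ne t 0 with h | h
        · simp [h]
        · rw [div_mul_cancel₀ _ (pow_ne_zero 2 h)]
          exact Real.sin_sq_le_one t
      linarith

lemma sincPow_abs (p t : ℝ) : sincPow p |t| = sincPow p t := by
  have : Real.sin |t| ^ 2 = Real.sin t ^ 2 := by
    rcases abs_choice t with h | h <;> simp [h]
  simp [sincPow, this]

lemma integral_sincPow_eq_two_mul (p : ℝ) :
    ∫ t, sincPow p t = 2 * ∫ t in Set.Ioi 0, sincPow p t := by
  rw [← integral_comp_abs]
  simp only [sincPow_abs]

lemma integral_sincPow_one : 1 / Real.pi * ∫ t, sincPow 1 t = 1 := by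
  rw [integral_sincPow_eq_two_mul]
  simp only [sincPow, Real.rpow_one, integral_sin_sq_div_sq]
  field_simp

/-- The moments `∫ uᵏ` for `k = 1, 2, 3` of `u = sin² t / t²` are `π/2` times `1`, `2/3`, `11/20`.
Under the law with density `(2/π) u dt` on `(0, ∞)` the variable `u` therefore has the same first
two moments as the law with masses `20/39` at `7/20` and `19/39` at `1`, and the latter is extremal
for the mean of `uᵉ`. -/
lemma integral_sincPow_one_add_le {e : ℝ} (he0 : 0 < e) (he1 : e ≤ 1) :
    1 / Real.pi * ∫ t, sincPow (1 + e) t ≤ 19 / 39 + 20 / 39 * (7 / 20 : ℝ) ^ e := by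
  obtain ⟨A, hA⟩ : ∃ A : ℝ, A = (7 / 20 : ℝ) ^ e := ⟨_, rfl⟩
  obtain ⟨B, hB⟩ : ∃ B : ℝ, B = e * (7 / 20 : ℝ) ^ (e - 1) := ⟨_, rfl⟩
  obtain ⟨c, hc⟩ : ∃ c : ℝ, c * (1 - 7 / 20) ^ 2 = 1 - A - B * (1 - 7 / 20) :=
    ⟨(1 - A - B * (1 - 7 / 20)) / (1 - 7 / 20) ^ 2, by norm_num⟩
  have i1 := integrableOn_sin_sq_div_sq.const_mul (A - B * (7 / 20) + c * (7 / 20) ^ 2)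
  have i2 := (integrableOn_sin_pow_div_pow (n := 4) (by norm_num)).const_mul (B - 2 * c * (7 / 20))
  have i3 := (integrableOn_sin_pow_div_pow (n := 6) (by norm_num)).const_mul c
  have key : ∫ t in Set.Ioi (0 : ℝ), sincPow (1 + e) t ≤ ∫ t in Set.Ioi (0 : ℝ),
      ((A - B * (7 / 20) + c * (7 / 20) ^ 2) * (Real.sin t ^ 2 / t ^ 2) +
        (B - 2 * c * (7 / 20)) * (Real.sin t ^ 4 / t ^ 4) + c * (Real.sin t ^ 6 / t ^ 6)) := by
    refine integral_mono (integrable_sincPow (by linarith)).integrableOn ((i1.add i2).add i3)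
      fun t => ?_
    have h0 : 0 ≤ Real.sin t ^ 2 / t ^ 2 := by positivity
    have h := rpow_le_hermite (l := 7 / 20) (u := Real.sin t ^ 2 / t ^ 2) (by norm_num)
      (by norm_num) he0 he1 h0 (sin_sq_div_sq_le_one t) (hA ▸ hB ▸ hc)
    rw [← hA, ← hB] at h
    have h4 : Real.sin t ^ 4 / t ^ 4 = (Real.sin t ^ 2 / t ^ 2) ^ 2 := by ring
    have h6 : Real.sin t ^ 6 / t ^ 6 = (Real.sin t ^ 2 / t ^ 2) ^ 3 := by ring
    simp only [sincPow, h4, h6]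
    rw [Real.rpow_one_add' h0 (by linarith)]
    refine (mul_le_mul_of_nonneg_left h h0).trans_eq ?_
    ring
  rw [integral_add (by exact i1.add i2) i3, integral_add i1 i2, integral_const_mul,
    integral_const_mul, integral_const_mul, integral_sin_sq_div_sq, integral_sin_pow_four_div,
    integral_sin_pow_six_div] at key
  rw [integral_sincPow_eq_two_mul, ← hA, one_div, inv_mul_le_iff₀ Real.pi_pos]
  have hc' : c = (1 - A - B * (13 / 20)) * (400 / 169) := by linarith
  subst hc'
  linarith

/-- The bound `(7/20) ^ e ≤ exp (-e) ≤ (1 + e + e²/2)⁻¹` reduces the claim to a polynomial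
inequality. -/
lemma weighted_rpow_lt_one_div_sqrt {e : ℝ} (he0 : 0 < e) (he1 : e ≤ 1) :
    19 / 39 + 20 / 39 * (7 / 20 : ℝ) ^ e < 1 / Real.sqrt (1 + e) := by
  have h1 : (7 / 20 : ℝ) ^ e ≤ 1 / (1 + e + e ^ 2 / 2) := by
    calc (7 / 20 : ℝ) ^ e ≤ Real.exp (-1) ^ e := by
          refine Real.rpow_le_rpow (by norm_num) ?_ he0.le
          have := Real.exp_neg_one_gt_d9
          linarith
      _ = 1 / Real.exp e := by
          rw [← Real.exp_mul, one_div, ← Real.exp_neg]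
          simp
      _ ≤ 1 / (1 + e + e ^ 2 / 2) :=
          one_div_le_one_div_of_le (by positivity) (Real.quadratic_le_exp_of_nonneg he0.le)
  have h2 : 19 / 39 + 20 / 39 * (1 / (1 + e + e ^ 2 / 2)) < 1 / Real.sqrt (1 + e) := by
    rw [lt_div_iff₀ (by positivity), mul_comm, ← lt_div_iff₀ (by positivity)]
    rw [Real.sqrt_lt' (by positivity)]
    have : 1 / (19 / 39 + 20 / 39 * (1 / (1 + e + e ^ 2 / 2))) =
      39 * (1 + e + e ^ 2 / 2) / (39 + 19 * (e + e ^ 2 / 2)) := by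
      field_simp
      ring
    rw [this, div_pow, lt_div_iff₀ (by positivity)]
    have : 0 < e ^ 2 := by positivity
    have : 0 < e ^ 3 := by positivity
    have : e ^ 5 ≤ e ^ 3 := pow_le_pow_of_le_one he0.le he1 (by norm_num)
    have : e ^ 4 ≤ e ^ 3 := pow_le_pow_of_le_one he0.le he1 (by norm_num)
    have : e ^ 3 ≤ e ^ 2 := pow_le_pow_of_le_one he0.le he1 (by norm_num)
    have : e ^ 2 ≤ e ^ 1 := pow_le_pow_of_le_one he0.le he1 (by norm_num)
    nlinarith
  linarith

lemma integral_sincPow_lt_one_div_sqrt {p : ℝ} (hp1 : 1 < p) (hp2 : p ≤ 2) :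
    1 / Real.pi * ∫ t, sincPow p t < 1 / Real.sqrt p := by
  have h := (integral_sincPow_one_add_le (e := p - 1) (by linarith) (by linarith)).trans_lt
    (weighted_rpow_lt_one_div_sqrt (by linarith) (by linarith))
  rwa [add_sub_cancel] at h

/-! ### The Gaussian bound -/

lemma nonneg_of_hasDerivAt_nonneg {f f' : ℝ → ℝ} (hd : ∀ x, HasDerivAt f (f' x) x)
    (h0 : f 0 = 0) (h : ∀ x, 0 ≤ x → 0 ≤ f' x) {x : ℝ} (hx : 0 ≤ x) : 0 ≤ f x := by
  have hmono : MonotoneOn f (Set.Ici 0) := by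
    refine monotoneOn_of_deriv_nonneg (convex_Ici 0)
      (fun y _ => (hd y).continuousAt.continuousWithinAt)
      (fun y _ => (hd y).differentiableAt.differentiableWithinAt) fun y hy => ?_
    rw [interior_Ici] at hy
    rw [(hd y).deriv]
    exact h y (le_of_lt hy)
  rw [← h0]
  exact hmono (Set.mem_Ici.2 le_rfl) hx hx

lemma exp_neg_le_quadratic {x : ℝ} (hx : 0 ≤ x) : Real.exp (-x) ≤ 1 - x + x ^ 2 / 2 := by
  have hd : ∀ y : ℝ, HasDerivAt (fun y : ℝ => 1 - y + y ^ 2 / 2 - Real.exp (-y))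
      (-1 + y + Real.exp (-y)) y := fun y =>
    ((((hasDerivAt_id y).const_sub 1).fun_add ((hasDerivAt_pow 2 y).div_const 2)).fun_sub
      (hasDerivAt_id y).neg.exp).congr_deriv (by simp)
  have := nonneg_of_hasDerivAt_nonneg hd (by simp)
    (fun y _ => by linarith [Real.add_one_le_exp (-y)]) hx
  linarith

lemma cubic_le_exp_neg {x : ℝ} (hx : 0 ≤ x) :
    1 - x + x ^ 2 / 2 - x ^ 3 / 6 ≤ Real.exp (-x) := by
  have hd : ∀ y : ℝ, HasDerivAt (fun y : ℝ => Real.exp (-y) - (1 - y + y ^ 2 / 2 - y ^ 3 / 6))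
      (1 - y + y ^ 2 / 2 - Real.exp (-y)) y := fun y =>
    ((hasDerivAt_id y).neg.exp.fun_sub
      ((((hasDerivAt_id y).const_sub 1).fun_add ((hasDerivAt_pow 2 y).div_const 2)).fun_sub
        ((hasDerivAt_pow 3 y).div_const 6))).congr_deriv (by simp; ring)
  have := nonneg_of_hasDerivAt_nonneg hd (by simp)
    (fun y hy => by linarith [exp_neg_le_quadratic hy]) hx
  linarith

lemma cos_le_quartic {x : ℝ} (hx : 0 ≤ x) : Real.cos x ≤ 1 - x ^ 2 / 2 + x ^ 4 / 24 := by
  have hd : ∀ y : ℝ, HasDerivAt (fun y : ℝ => 1 - y ^ 2 / 2 + y ^ 4 / 24 - Real.cos y)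
      (-y + y ^ 3 / 6 + Real.sin y) y := fun y =>
    (((((hasDerivAt_pow 2 y).div_const 2).const_sub 1).fun_add
      ((hasDerivAt_pow 4 y).div_const 24)).fun_sub
        (Real.hasDerivAt_cos y)).congr_deriv (by simp; ring)
  have := nonneg_of_hasDerivAt_nonneg hd (by simp)
    (fun y hy => by linarith [Real.sin_ge_sub_cube hy]) hx
  linarith

lemma sin_le_quintic {x : ℝ} (hx : 0 ≤ x) : Real.sin x ≤ x - x ^ 3 / 6 + x ^ 5 / 120 := by
  have hd : ∀ y : ℝ, HasDerivAt (fun y : ℝ => y - y ^ 3 / 6 + y ^ 5 / 120 - Real.sin y)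
      (1 - y ^ 2 / 2 + y ^ 4 / 24 - Real.cos y) y := fun y =>
    ((((hasDerivAt_id y).fun_sub ((hasDerivAt_pow 3 y).div_const 6)).fun_add
      ((hasDerivAt_pow 5 y).div_const 120)).fun_sub
        (Real.hasDerivAt_sin y)).congr_deriv (by simp; ring)
  have := nonneg_of_hasDerivAt_nonneg hd (by simp)
    (fun y hy => by linarith [cos_le_quartic hy]) hx
  linarith

/-- The bound `sin t / t ≤ exp (-t²/6)`. Comparing Taylor polynomials of the two sides, the
difference is at least `t⁴ (1/180 - t²/1296)`, which is nonnegative exactly for `t² ≤ 36/5`. -/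
lemma sin_le_mul_exp {t : ℝ} (ht : 0 ≤ t) (ht2 : t ^ 2 ≤ 36 / 5) :
    Real.sin t ≤ t * Real.exp (-(t ^ 2 / 6)) := by
  have h1 := sin_le_quintic ht
  have h2 := mul_le_mul_of_nonneg_left (cubic_le_exp_neg (x := t ^ 2 / 6) (by positivity)) ht
  have h3 : 0 ≤ t ^ 5 * (36 / 5 - t ^ 2) := mul_nonneg (by positivity) (by linarith)
  nlinarith

lemma sincPow_le_exp {p t : ℝ} (hp : 0 ≤ p) (ht : 0 < t) (ht2 : t ^ 2 ≤ 36 / 5) :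
    sincPow p t ≤ Real.exp (-(p / 3) * t ^ 2) := by
  have hs : 0 ≤ Real.sin t :=
    Real.sin_nonneg_of_nonneg_of_le_pi ht.le (by nlinarith [Real.pi_gt_three])
  have h1 : Real.sin t ^ 2 / t ^ 2 ≤ Real.exp (-(t ^ 2 / 3)) := by
    rw [div_le_iff₀ (by positivity)]
    refine (pow_le_pow_left₀ hs (sin_le_mul_exp ht.le ht2) 2).trans_eq ?_
    rw [mul_pow, ← Real.exp_nat_mul, mul_comm]
    congr 2
    push_cast
    ring
  refine (Real.rpow_le_rpow (by positivity) h1 hp).trans_eq ?_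
  rw [← Real.exp_mul]
  congr 1
  ring

lemma sincPow_le_rpow {p t : ℝ} (hp : 0 ≤ p) (ht : 0 < t) : sincPow p t ≤ t ^ (-(2 * p)) := by
  have h1 : Real.sin t ^ 2 / t ^ 2 ≤ t ^ (-2 : ℝ) := by
    rw [Real.rpow_neg ht.le, Real.rpow_two, div_eq_mul_inv]
    exact mul_le_of_le_one_left (by positivity) (Real.sin_sq_le_one t)
  refine (Real.rpow_le_rpow (by positivity) h1 hp).trans_eq ?_
  rw [← Real.rpow_mul ht.le]
  congr 1
  ring

/-- Gaussian domination up to `6/√5`, and `|sin t| ≤ 1` beyond. -/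
lemma integral_sincPow_lt {p : ℝ} (hp : 1 ≤ p) :
    1 / Real.pi * ∫ t, sincPow p t <
      (1 + 1 / Real.sqrt (3 * Real.pi) * tailTerm p) * (Real.sqrt (3 / Real.pi) / Real.sqrt p) := by
  have hp0 : 0 < p := by linarith
  have h5 : 0 < Real.sqrt 5 := by positivity
  obtain ⟨T, hT⟩ : ∃ T : ℝ, T = 6 / Real.sqrt 5 := ⟨_, rfl⟩
  have hT0 : 0 < T := by rw [hT]; positivity
  have hTT : T ^ 2 = 36 / 5 := by
    rw [hT, div_pow, Real.sq_sqrt (by norm_num)]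
    norm_num
  have hint := (integrable_sincPow hp).integrableOn (s := Set.Ioi 0)
  have hgauss := integrable_exp_neg_mul_sq (b := p / 3) (by positivity)
  have hsplit : ∀ f : ℝ → ℝ, IntegrableOn f (Set.Ioi 0) →
      ∫ t in Set.Ioi 0, f t = (∫ t in Set.Ioc 0 T, f t) + ∫ t in Set.Ioi T, f t := by
    intro f hf
    rw [← Set.Ioc_union_Ioi_eq_Ioi hT0.le] at hf ⊢
    exact setIntegral_union Set.Ioc_disjoint_Ioi_same measurableSet_Ioi
      hf.left_of_union hf.right_of_union
  have hnear : ∫ t in Set.Ioc 0 T, sincPow p t ≤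
      ∫ t in Set.Ioc 0 T, Real.exp (-(p / 3) * t ^ 2) := by
    refine setIntegral_mono_on (integrable_sincPow hp).integrableOn hgauss.integrableOn
      measurableSet_Ioc fun t ht => sincPow_le_exp hp0.le ht.1 ?_
    rw [← hTT]
    exact pow_le_pow_left₀ ht.1.le ht.2 2
  have hfar : ∫ t in Set.Ioi T, sincPow p t ≤ ∫ t in Set.Ioi T, t ^ (-(2 * p)) :=
    setIntegral_mono_on (integrable_sincPow hp).integrableOn
      (integrableOn_Ioi_rpow_of_lt (by linarith) hT0) measurableSet_Ioi
      fun t ht => sincPow_le_rpow hp0.le (hT0.trans ht)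
  have hpos : 0 < ∫ t in Set.Ioi T, Real.exp (-(p / 3) * t ^ 2) := by
    have : NeZero (volume.restrict (Set.Ioi T)) := ⟨by simp [Measure.restrict_eq_zero]⟩
    exact integral_exp_pos hgauss.integrableOn
  have htot := hsplit _ hgauss.integrableOn
  rw [integral_gaussian_Ioi] at htot
  rw [integral_Ioi_rpow_of_lt (by linarith) hT0] at hfar
  have hTpow : T ^ (-(2 * p) + 1) = (Real.sqrt 5 / 6) ^ (2 * p - 1) := by
    rw [show -(2 * p) + 1 = -(2 * p - 1) by ring, Real.rpow_neg hT0.le, ← Real.inv_rpow hT0.le,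
      hT, inv_div]
  rw [hTpow] at hfar
  have hlt : ∫ t in Set.Ioi 0, sincPow p t < Real.sqrt (Real.pi / (p / 3)) / 2 +
      (Real.sqrt 5 / 6) ^ (2 * p - 1) / (2 * p - 1) := by
    rw [hsplit _ hint]
    have : -(Real.sqrt 5 / 6) ^ (2 * p - 1) / (-(2 * p) + 1) =
        (Real.sqrt 5 / 6) ^ (2 * p - 1) / (2 * p - 1) := by
      rw [show -(2 * p) + 1 = -(2 * p - 1) by ring, neg_div_neg_eq]
    linarith
  rw [integral_sincPow_eq_two_mul, one_div, inv_mul_lt_iff₀ Real.pi_pos]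
  refine (mul_lt_mul_of_pos_left hlt two_pos).trans_eq ?_
  rw [tailTerm]
  obtain ⟨X, hX⟩ : ∃ X : ℝ, X = (Real.sqrt 5 / 6) ^ (2 * p - 1) := ⟨_, rfl⟩
  obtain ⟨s, hs0, hs⟩ : ∃ s : ℝ, 0 < s ∧ p = s ^ 2 :=
    ⟨Real.sqrt p, by positivity, (Real.sq_sqrt hp0.le).symm⟩
  obtain ⟨a, ha0, ha⟩ : ∃ a : ℝ, 0 < a ∧ 3 = a ^ 2 :=
    ⟨Real.sqrt 3, by positivity, (Real.sq_sqrt (by norm_num)).symm⟩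
  obtain ⟨b, hb0, hb⟩ : ∃ b : ℝ, 0 < b ∧ Real.pi = b ^ 2 :=
    ⟨Real.sqrt Real.pi, by positivity, (Real.sq_sqrt Real.pi_pos.le).symm⟩
  have e1 : Real.sqrt (Real.pi / (p / 3)) = a * b / s := by
    rw [Real.sqrt_eq_iff_mul_self_eq (by positivity) (by positivity), hs, hb, ha]
    field_simp
  have e2 : Real.sqrt (3 * Real.pi) = a * b := by
    rw [Real.sqrt_eq_iff_mul_self_eq (by positivity) (by positivity), hb, ha]
    ring
  have e3 : Real.sqrt (3 / Real.pi) = a / b := by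
    rw [Real.sqrt_eq_iff_mul_self_eq (by positivity) (by positivity), hb, ha]
    field_simp
  have e4 : Real.sqrt p = s := by rw [hs, Real.sqrt_sq hs0.le]
  rw [e1, e2, e3, e4, hb, ← hX, hs]
  have hden : 2 * s ^ 2 - 1 ≠ 0 := by
    rw [← hs]
    linarith
  have hden' : s - 1 / (2 * s) = (2 * s ^ 2 - 1) / (2 * s) := by field_simp
  rw [hden']
  field_simp

/-! ### The threshold -/

lemma sqrt_sub_one_div_two_mul_sqrt {p : ℝ} (hp : 0 < p) :
    Real.sqrt p - 1 / (2 * Real.sqrt p) = (2 * p - 1) / (2 * Real.sqrt p) := by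
  have hs : 0 < Real.sqrt p := Real.sqrt_pos.2 hp
  have h : Real.sqrt p ^ 2 = p := Real.sq_sqrt hp.le
  field_simp
  rw [h, mul_comm]

lemma sqrt_five_div_six_lt_one : Real.sqrt 5 / 6 < 1 := by
  have : Real.sqrt 5 < 6 := (Real.sqrt_lt' (by norm_num)).2 (by norm_num)
  linarith

lemma tailTerm_strictAntiOn : StrictAntiOn tailTerm (Set.Ioi (1 / 2)) := by
  intro p hp q hq hpq
  have hp' : 1 / 2 < p := hp
  have hsp : 0 < Real.sqrt p := Real.sqrt_pos.2 (by linarith)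
  have hs : Real.sqrt p < Real.sqrt q := Real.sqrt_lt_sqrt (by linarith) hpq
  have hden : 0 < Real.sqrt p - 1 / (2 * Real.sqrt p) := by
    rw [sqrt_sub_one_div_two_mul_sqrt (by linarith)]
    exact div_pos (by linarith) (by positivity)
  refine div_lt_div₀' ?_ ?_ (by positivity) hden
  · exact Real.rpow_le_rpow_of_exponent_ge (by positivity) sqrt_five_div_six_lt_one.le
      (by linarith)
  · have : 1 / (2 * Real.sqrt q) < 1 / (2 * Real.sqrt p) :=
      one_div_lt_one_div_of_lt (by positivity) (by linarith)
    linarith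

/-- At `p = 1/2` the denominator of `tailTerm` vanishes and `tailTerm p = 0`. -/
lemma tailTerm_nonpos {p : ℝ} (hp : 0 < p) (hp2 : p ≤ 1 / 2) : tailTerm p ≤ 0 := by
  rw [tailTerm, sqrt_sub_one_div_two_mul_sqrt hp]
  exact div_nonpos_of_nonneg_of_nonpos (by positivity)
    (div_nonpos_of_nonpos_of_nonneg (by linarith) (by positivity))

lemma continuousOn_tailTerm : ContinuousOn tailTerm (Set.Ioi (1 / 2)) := by
  intro p hp
  have hp' : 1 / 2 < p := hp
  have hsp : 0 < Real.sqrt p := Real.sqrt_pos.2 (by linarith)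
  have hden : Real.sqrt p - 1 / (2 * Real.sqrt p) ≠ 0 := by
    rw [sqrt_sub_one_div_two_mul_sqrt (by linarith)]
    exact (div_pos (by linarith) (by positivity)).ne'
  have hbase : Real.sqrt 5 / 6 ≠ 0 := by positivity
  have h1 : ContinuousAt (fun p : ℝ => (Real.sqrt 5 / 6) ^ (2 * p - 1)) p :=
    ContinuousAt.rpow continuousAt_const (by fun_prop) (Or.inl hbase)
  have h2 : ContinuousAt (fun p : ℝ => Real.sqrt p - 1 / (2 * Real.sqrt p)) p := by
    have : 2 * Real.sqrt p ≠ 0 := by positivity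
    fun_prop (disch := assumption)
  exact (h1.div h2 hden).continuousWithinAt

lemma one_sub_sqrt_mul_pi :
    (1 - Real.sqrt (3 / Real.pi)) * Real.pi = Real.pi - Real.sqrt (3 * Real.pi) := by
  have hpi := Real.pi_pos
  have : Real.sqrt (3 * Real.pi) = Real.sqrt (3 / Real.pi) * Real.pi := by
    rw [Real.sqrt_eq_iff_mul_self_eq (by positivity) (by positivity), mul_mul_mul_comm,
      Real.mul_self_sqrt (by positivity)]
    field_simp
  rw [this]
  ring

lemma threshold_rhs_bounds : 0.071611 < (1 - Real.sqrt (3 / Real.pi)) * Real.pi ∧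
    (1 - Real.sqrt (3 / Real.pi)) * Real.pi < 0.071614 := by
  have h1 := Real.pi_gt_d6
  have h2 := Real.pi_lt_d6
  have h3 : 3.069979 < Real.sqrt (3 * Real.pi) :=
    (Real.lt_sqrt (by norm_num)).2 (by norm_num; linarith)
  have h4 : Real.sqrt (3 * Real.pi) < 3.069981 :=
    (Real.sqrt_lt' (by norm_num)).2 (by norm_num; linarith)
  rw [one_sub_sqrt_mul_pi]
  constructor <;> linarith

/-- The numerator as an exponential, through `(√5/6) ^ 2 = 5/36`, so that bounds for `log 2`,
`log 3` and `log 5` apply. -/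
lemma tailTerm_eq {p : ℝ} (hp : 0 < p) : tailTerm p =
    Real.exp (-((p - 1 / 2) * (2 * Real.log 2 + 2 * Real.log 3 - Real.log 5))) /
      ((2 * p - 1) / (2 * Real.sqrt p)) := by
  rw [tailTerm, sqrt_sub_one_div_two_mul_sqrt hp, Real.rpow_def_of_pos (by positivity),
    Real.log_div (by positivity) (by norm_num), Real.log_sqrt (by norm_num),
    show (6 : ℝ) = 2 * 3 by norm_num, Real.log_mul (by norm_num) (by norm_num)]
  congr 2
  ring

lemma lt_tailTerm_of_lower_endpoint : 0.071614 < tailTerm 1.84135 := by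
  have hs : Real.sqrt 1.84135 < 1.356965 := (Real.sqrt_lt' (by norm_num)).2 (by norm_num)
  have hs' : 1.35696 < Real.sqrt 1.84135 := (Real.lt_sqrt (by norm_num)).2 (by norm_num)
  have hexp : 0.070796 < Real.exp (-((1.84135 - 1 / 2) *
      (2 * Real.log 2 + 2 * Real.log 3 - Real.log 5))) := by
    have hE : (1.84135 - 1 / 2) * (2 * Real.log 2 + 2 * Real.log 3 - Real.log 5) < 2.647935 := by
      linarith [Real.log_two_lt_d9, Real.log_three_lt_d9, Real.log_five_gt_d9]
    have h1 : Real.exp 2.647935 < 14.1249 := by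
      have h2 := Real.exp_bound' (x := 0.647935) (by norm_num) (by norm_num)
        (n := 9) (by norm_num)
      norm_num [Finset.sum_range_succ, Nat.factorial] at h2
      have h3 := Real.exp_one_lt_d9
      have h4 : Real.exp 2.647935 = Real.exp 1 * Real.exp 1 * Real.exp 0.647935 := by
        rw [← Real.exp_add, ← Real.exp_add]
        norm_num
      rw [h4]
      calc Real.exp 1 * Real.exp 1 * Real.exp 0.647935
          ≤ 2.7182818286 * 2.7182818286 * 1.9115898 := by
            gcongr
            norm_num
            linarith
        _ < 14.1249 := by norm_num
    calc (0.070796 : ℝ) < 1 / 14.1249 := by norm_num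
      _ < 1 / Real.exp 2.647935 := one_div_lt_one_div_of_lt (Real.exp_pos _) h1
      _ = Real.exp (-2.647935) := by rw [Real.exp_neg, one_div]
      _ < _ := Real.exp_lt_exp.2 (by linarith)
  rw [tailTerm_eq (by norm_num), lt_div_iff₀ (div_pos (by norm_num) (by positivity))]
  have : (2 * 1.84135 - 1) / (2 * Real.sqrt 1.84135) < 0.9885 := by
    rw [div_lt_iff₀ (by positivity)]
    linarith
  linarith

lemma tailTerm_lt_of_upper_endpoint : tailTerm 1.84145 < 0.071611 := by
  have hs : Real.sqrt 1.84145 < 1.357001 := (Real.sqrt_lt' (by norm_num)).2 (by norm_num)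
  have hexp : Real.exp (-((1.84145 - 1 / 2) *
      (2 * Real.log 2 + 2 * Real.log 3 - Real.log 5))) < 0.070784 := by
    have hE : 2.64813 < (1.84145 - 1 / 2) * (2 * Real.log 2 + 2 * Real.log 3 - Real.log 5) := by
      linarith [Real.log_two_gt_d9, Real.log_three_gt_d9, Real.log_five_lt_d9]
    have h1 : 14.1275 < Real.exp 2.64813 := by
      have h2 := Real.sum_le_exp_of_nonneg (x := 0.64813) (by norm_num) 9
      norm_num [Finset.sum_range_succ, Nat.factorial] at h2
      have h3 := Real.exp_one_gt_d9
      have h4 : Real.exp 2.64813 = Real.exp 1 * Real.exp 1 * Real.exp 0.64813 := by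
        rw [← Real.exp_add, ← Real.exp_add]
        norm_num
      rw [h4]
      calc (14.1275 : ℝ) < 2.7182818283 * 2.7182818283 * 1.91196 := by norm_num
        _ ≤ Real.exp 1 * Real.exp 1 * Real.exp 0.64813 := by
            gcongr
            norm_num
            linarith
    calc _ < Real.exp (-2.64813) := Real.exp_lt_exp.2 (by linarith)
      _ = 1 / Real.exp 2.64813 := by rw [Real.exp_neg, one_div]
      _ < 1 / 14.1275 := one_div_lt_one_div_of_lt (by norm_num) h1
      _ < 0.070784 := by norm_num
  rw [tailTerm_eq (by norm_num), div_lt_iff₀ (div_pos (by norm_num) (by positivity))]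
  have : 0.98853 < (2 * 1.84145 - 1) / (2 * Real.sqrt 1.84145) := by
    rw [lt_div_iff₀ (by positivity)]
    linarith
  linarith

lemma exists_threshold :
    ∃ p₀ : ℝ, ThresholdEq p₀ ∧ |p₀ - 1.8414| < 0.00005 := by
  have hcont : ContinuousOn tailTerm (Set.Icc 1.84135 1.84145) :=
    continuousOn_tailTerm.mono fun x hx => lt_of_lt_of_le (by norm_num) hx.1
  obtain ⟨p, hp, hpe⟩ := intermediate_value_Ioo' (by norm_num) hcont
    ⟨tailTerm_lt_of_upper_endpoint.trans threshold_rhs_bounds.1,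
      threshold_rhs_bounds.2.trans lt_tailTerm_of_lower_endpoint⟩
  refine ⟨p, hpe, abs_lt.2 ⟨?_, ?_⟩⟩
  · linarith [hp.1]
  · linarith [hp.2]

lemma ThresholdEq.eq_of_pos {p q : ℝ} (hp : ThresholdEq p) (hp0 : 0 < p) (hq : ThresholdEq q)
    (hq0 : 0 < q) : q = p := by
  have hhalf : ∀ r : ℝ, 0 < r → ThresholdEq r → r ∈ Set.Ioi (1 / 2 : ℝ) := by
    intro r hr hre
    by_contra h
    have h1 := tailTerm_nonpos hr (not_lt.1 h)
    rw [ThresholdEq] at hre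
    linarith [threshold_rhs_bounds.1]
  exact tailTerm_strictAntiOn.injOn (hhalf q hq0 hq) (hhalf p hp0 hp) (hq.trans hp.symm)

/-! ### The limit -/

/-- For `t ≤ 1` this combines `sin t / t ≥ 1 - x`, `1 - x ≥ e⁻ˣ (1 - x²)` and Bernoulli's
inequality, with `x = t²/6`. For `t > 1` and `p ≥ 18` the left-hand side is nonpositive. -/
lemma exp_mul_le_sincPow {p t : ℝ} (hp : 18 ≤ p) (ht : 0 < t) :
    Real.exp (-(p / 3) * t ^ 2) * (1 - p * t ^ 4 / 18) ≤ sincPow p t := by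
  rcases le_or_gt t 1 with ht1 | ht1
  · obtain ⟨x, hx⟩ : ∃ x : ℝ, x = t ^ 2 / 6 := ⟨_, rfl⟩
    have ht2 : t ^ 2 ≤ 1 := pow_le_one₀ ht.le ht1
    have hx0 : 0 ≤ x := by rw [hx]; positivity
    have hx1 : x ≤ 1 := by linarith
    have hx2 : 0 ≤ 1 - x ^ 2 := by nlinarith
    have h1 : Real.exp (-x) * (1 - x ^ 2) ≤ 1 - x := by
      rw [Real.exp_neg, inv_mul_le_iff₀ (Real.exp_pos x)]
      nlinarith [Real.add_one_le_exp x]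
    have h2 : 1 - x ≤ Real.sin t / t := by
      rw [le_div_iff₀ ht, hx]
      linarith [Real.sin_gt_sub_cube ht]
    have h3 : (Real.exp (-x) * (1 - x ^ 2)) ^ 2 ≤ Real.sin t ^ 2 / t ^ 2 := by
      rw [← div_pow]
      exact pow_le_pow_left₀ (by positivity) (h1.trans h2) 2
    have h4 : Real.exp (-(p / 3) * t ^ 2) * ((1 - x ^ 2) ^ 2) ^ p =
        ((Real.exp (-x) * (1 - x ^ 2)) ^ 2) ^ p := by
      rw [mul_pow, Real.mul_rpow (by positivity) (by positivity), ← Real.exp_nat_mul,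
        ← Real.exp_mul, hx]
      congr 2
      push_cast
      ring
    have h5 : 1 - p * t ^ 4 / 18 ≤ ((1 - x ^ 2) ^ 2) ^ p := by
      have hb := one_add_mul_self_le_rpow_one_add (s := -x ^ 2) (by linarith) (p := 2 * p)
        (by linarith)
      rw [← Real.rpow_two, ← Real.rpow_mul hx2]
      rw [← sub_eq_add_neg] at hb
      refine le_trans (le_of_eq ?_) hb
      rw [hx]
      ring
    calc _ ≤ Real.exp (-(p / 3) * t ^ 2) * ((1 - x ^ 2) ^ 2) ^ p := by gcongr
      _ = _ := h4
      _ ≤ sincPow p t := Real.rpow_le_rpow (by positivity) h3 (by linarith)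
  · have h1 : 1 ≤ t ^ 4 := one_le_pow₀ ht1.le
    have h2 : 1 - p * t ^ 4 / 18 ≤ 0 := by nlinarith
    exact (mul_nonpos_of_nonneg_of_nonpos (Real.exp_pos _).le h2).trans (sincPow_nonneg p t)

lemma integral_pow_four_mul_gaussian_Ioi {b : ℝ} (hb : 0 < b) :
    ∫ t in Set.Ioi (0 : ℝ), t ^ 4 * Real.exp (-b * t ^ 2) =
      3 / (4 * b ^ 2) * (Real.sqrt (Real.pi / b) / 2) := by
  have h := integral_rpow_mul_exp_neg_mul_rpow (p := 2) (q := 4) (b := b) two_pos (by norm_num) hb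
  have hG : Real.Gamma ((4 + 1) / 2) = 3 / 4 * Real.sqrt Real.pi := by
    rw [show ((4 : ℝ) + 1) / 2 = (1 / 2 + 1) + 1 by norm_num, Real.Gamma_add_one (by norm_num),
      Real.Gamma_add_one (by norm_num), Real.Gamma_one_half_eq]
    ring
  have hb5 : b ^ (-((4 : ℝ) + 1) / 2) = (b ^ 2 * Real.sqrt b)⁻¹ := by
    rw [show -((4 : ℝ) + 1) / 2 = -(2 + 1 / 2) by norm_num, Real.rpow_neg hb.le,
      Real.rpow_add hb, Real.rpow_two, ← Real.sqrt_eq_rpow]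
  rw [hG, hb5] at h
  have hcongr : ∫ t in Set.Ioi (0 : ℝ), t ^ 4 * Real.exp (-b * t ^ 2) =
      ∫ t in Set.Ioi (0 : ℝ), t ^ (4 : ℝ) * Real.exp (-b * t ^ (2 : ℝ)) := by
    refine setIntegral_congr_fun measurableSet_Ioi fun t _ => ?_
    simp only [Real.rpow_two]
    norm_cast
  have hsb : 0 < Real.sqrt b := Real.sqrt_pos.2 hb
  rw [hcongr, h, Real.sqrt_div' _ hb.le]
  field_simp

lemma gaussian_lower_bound_le_integral_sincPow {p : ℝ} (hp : 18 ≤ p) :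
    (1 - 3 / (8 * p)) * (Real.sqrt (3 / Real.pi) / Real.sqrt p) ≤
      1 / Real.pi * ∫ t, sincPow p t := by
  have hp0 : 0 < p := by linarith
  have hpi := Real.pi_pos
  have hg := (integrable_exp_neg_mul_sq (b := p / 3) (by positivity)).integrableOn
    (s := Set.Ioi 0)
  have hg4 : IntegrableOn (fun t : ℝ => t ^ 4 * Real.exp (-(p / 3) * t ^ 2)) (Set.Ioi 0) := by
    have := (integrable_rpow_mul_exp_neg_mul_sq (b := p / 3) (by positivity)
      (s := 4) (by norm_num)).integrableOn (s := Set.Ioi 0)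
    exact_mod_cast this
  have key : ∫ t in Set.Ioi (0 : ℝ), (Real.exp (-(p / 3) * t ^ 2) -
      p / 18 * (t ^ 4 * Real.exp (-(p / 3) * t ^ 2))) ≤ ∫ t in Set.Ioi 0, sincPow p t := by
    refine setIntegral_mono_on (hg.sub (hg4.const_mul _))
      (integrable_sincPow (by linarith)).integrableOn measurableSet_Ioi fun t ht => ?_
    refine le_trans (le_of_eq ?_) (exp_mul_le_sincPow hp ht)
    ring
  rw [integral_sub hg (hg4.const_mul _), integral_const_mul, integral_gaussian_Ioi,
    integral_pow_four_mul_gaussian_Ioi (by positivity)] at key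
  have hs : Real.sqrt (Real.pi / (p / 3)) = Real.pi * (Real.sqrt (3 / Real.pi) / Real.sqrt p) := by
    have hsp : Real.sqrt p * Real.sqrt p = p := Real.mul_self_sqrt hp0.le
    have h3 : Real.sqrt (3 / Real.pi) * Real.sqrt (3 / Real.pi) = 3 / Real.pi :=
      Real.mul_self_sqrt (by positivity)
    rw [Real.sqrt_eq_iff_mul_self_eq (by positivity) (by positivity), eq_comm]
    calc _ = Real.pi ^ 2 * (Real.sqrt (3 / Real.pi) * Real.sqrt (3 / Real.pi)) /
          (Real.sqrt p * Real.sqrt p) := by ring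
      _ = _ := by
        rw [hsp, h3]
        field_simp
  rw [hs] at key
  rw [integral_sincPow_eq_two_mul, one_div, le_inv_mul_iff₀ hpi]
  refine le_trans (le_of_eq ?_) (mul_le_mul_of_nonneg_left key zero_le_two)
  field_simp
  ring

lemma tailTerm_le {p : ℝ} (hp : 1 ≤ p) : tailTerm p ≤ 2 / Real.sqrt p := by
  have hs : 1 ≤ Real.sqrt p := Real.one_le_sqrt.2 hp
  have hden : Real.sqrt p / 2 ≤ Real.sqrt p - 1 / (2 * Real.sqrt p) := by
    have : 1 / (2 * Real.sqrt p) ≤ 1 / 2 := one_div_le_one_div_of_le two_pos (by linarith)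
    linarith
  rw [tailTerm, show 2 / Real.sqrt p = 1 / (Real.sqrt p / 2) by field_simp]
  refine div_le_div₀ zero_le_one ?_ (by positivity) hden
  exact Real.rpow_le_one (by positivity) sqrt_five_div_six_lt_one.le (by linarith)

lemma tendsto_integral_sincPow_ratio :
    Tendsto (fun p : ℝ => (1 / Real.pi * ∫ t : ℝ, sincPow p t)
      / (Real.sqrt (3 / Real.pi) / Real.sqrt p)) atTop (𝓝 1) := by
  have hpi := Real.pi_pos
  have hlo : Tendsto (fun p : ℝ => 1 - 3 / (8 * p)) atTop (𝓝 1) := by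
    have : Tendsto (fun p : ℝ => 3 / (8 * p)) atTop (𝓝 0) :=
      tendsto_const_nhds.div_atTop (tendsto_id.const_mul_atTop (by norm_num))
    simpa using this.const_sub 1
  have hhi : Tendsto (fun p : ℝ => 1 + 1 / Real.sqrt (3 * Real.pi) * (2 / Real.sqrt p)) atTop
      (𝓝 1) := by
    have : Tendsto (fun p : ℝ => 2 / Real.sqrt p) atTop (𝓝 0) :=
      tendsto_const_nhds.div_atTop Real.tendsto_sqrt_atTop
    simpa using (this.const_mul (1 / Real.sqrt (3 * Real.pi))).const_add 1
  refine tendsto_of_tendsto_of_tendsto_of_le_of_le' hlo hhi ?_ ?_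
  · filter_upwards [eventually_ge_atTop 18] with p hp
    have hp0 : 0 < p := by linarith
    rw [le_div_iff₀ (by positivity)]
    exact gaussian_lower_bound_le_integral_sincPow hp
  · filter_upwards [eventually_ge_atTop 1] with p hp
    have hp0 : 0 < p := by linarith
    rw [div_le_iff₀ (by positivity)]
    refine (integral_sincPow_lt hp).le.trans ?_
    gcongr
    exact tailTerm_le hp

/-! ### The inequality with the piecewise constant -/

theorem theorem1 :
    ∃ p₀ : ℝ,
      -- `p₀` is the unique positive solution of its equation, and `p₀ = 1.8414` to 4 decimals
      (0 < p₀ ∧ ThresholdEq p₀ ∧ ∀ q : ℝ, 0 < q → ThresholdEq q → q = p₀) ∧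
      |p₀ - 1.8414| < 0.00005 ∧
      (∀ p : ℝ, 1 ≤ p →
        Integrable (sincPow p) ∧
        (1 / Real.pi * ∫ t : ℝ, sincPow p t)
          ≤ ballConst p₀ p * (Real.sqrt (3 / Real.pi) / Real.sqrt p) ∧
        ballConst p₀ p * (Real.sqrt (3 / Real.pi) / Real.sqrt p) ≤ 1 / Real.sqrt p ∧
        ((1 / Real.pi * ∫ t : ℝ, sincPow p t)
          = ballConst p₀ p * (Real.sqrt (3 / Real.pi) / Real.sqrt p) ↔ p = 1)) ∧
      Tendsto
        (fun p : ℝ => (1 / Real.pi * ∫ t : ℝ, sincPow p t)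
          / (Real.sqrt (3 / Real.pi) / Real.sqrt p))
        atTop (𝓝 1) := by
  obtain ⟨p₀, he, habs⟩ := exists_threshold
  have hb := abs_lt.1 habs
  have hp₀ : 0 < p₀ := by linarith
  have hpi := Real.pi_pos
  refine ⟨p₀, ⟨hp₀, he, fun q hq hqe => he.eq_of_pos hp₀ hqe hq⟩, habs, fun p hp => ?_,
    tendsto_integral_sincPow_ratio⟩
  have hp0 : 0 < p := by linarith
  refine ⟨integrable_sincPow hp, ?_⟩
  rcases le_or_gt p p₀ with hpp | hpp
  · have hC : ballConst p₀ p * (Real.sqrt (3 / Real.pi) / Real.sqrt p) = 1 / Real.sqrt p := by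
      rw [ballConst, if_pos hpp, ← mul_div_assoc, ← Real.sqrt_mul (by positivity)]
      congr 1
      rw [Real.sqrt_eq_one]
      field_simp
    rw [hC]
    rcases eq_or_lt_of_le hp with h1 | h1
    · subst h1
      rw [integral_sincPow_one]
      simp
    · have hlt := integral_sincPow_lt_one_div_sqrt h1 (by linarith)
      exact ⟨hlt.le, le_rfl, fun h => absurd h hlt.ne, fun h => absurd h h1.ne'⟩
  · have hlt := integral_sincPow_lt hp
    have hC : ballConst p₀ p = 1 + 1 / Real.sqrt (3 * Real.pi) * tailTerm p := by
      rw [ballConst, if_neg (not_le.2 hpp)]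
    rw [hC]
    refine ⟨hlt.le, ?_, fun h => absurd h hlt.ne, fun h => by linarith⟩
    have htail : tailTerm p ≤ Real.pi - Real.sqrt (3 * Real.pi) := by
      rw [← one_sub_sqrt_mul_pi, ← he]
      exact (tailTerm_strictAntiOn (Set.mem_Ioi.2 (by linarith))
        (Set.mem_Ioi.2 (by linarith)) hpp).le
    have hs : 0 < Real.sqrt (3 * Real.pi) := by positivity
    have hprod : Real.pi / Real.sqrt (3 * Real.pi) * Real.sqrt (3 / Real.pi) = 1 := by
      rw [div_mul_eq_mul_div, div_eq_one_iff_eq hs.ne', eq_comm,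
        Real.sqrt_eq_iff_mul_self_eq (by positivity) (by positivity), mul_mul_mul_comm,
        Real.mul_self_sqrt (by positivity)]
      field_simp
    rw [← mul_div_assoc]
    gcongr
    calc _ ≤ (1 + 1 / Real.sqrt (3 * Real.pi) * (Real.pi - Real.sqrt (3 * Real.pi))) *
          Real.sqrt (3 / Real.pi) := by gcongr
      _ = Real.pi / Real.sqrt (3 * Real.pi) * Real.sqrt (3 / Real.pi) := by
        field_simp
        ring
      _ = 1 := hprod
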